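/- Let $\mathcal X\subset\mathbb R^n$ be a $C^1$ submanifold of dimension $d$ with tangent space $T_{\mathcal X}(x)$ at $x \in \mathcal X$, and let $S:\mathcal X\rightrightarrows\mathbb R^m$ be a set-valued map (regarded as a set-valued map on $\mathbb R^n$ with empty values off $\mathcal X$) whose graph $\operatorname{Graph}(S)=\{(x,y): y\in S(x)\}\subset\mathbb R^{n+m}$ is locally closed at a point $(\bar x,\bar y)\in\operatorname{Graph}(S)$, i.e. its intersection with some closed neighbourhood of $(\bar x,\bar y)$ is closed. For $D\subset\mathbb R^{N}$ and $z\in D$ let $\hat N_D(z)=\{v: \langle v,z'-z\rangle\le o(|z'-z|)\text{ for }z'\in D\}$, and let the limiting normal cone $N_D(\bar z)$ be the set of all limits of sequences $v_i\in\hat N_D(z_i)$ with $z_i\in D$, $z_i\to\bar z$. Let $D^*S(\bar x\mid\bar y)(y^*)=\{x^*:(x^*,-y^*)\in N_{\operatorname{Graph}(S)}(\bar x,\bar y)\}$ and define $H:\mathbb R^m\rightrightarrows\mathbb R^n$ by $$H(y^*)=D^*S(\bar x\mid\bar y)(y^*)\cap T_{\mathcal X}(\bar x).$$ For $\kappa\ge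 0$, say that $\kappa$ is admissible if there are neighbourhoods $V$ of $\bar x$ and $W$ of $\bar y$ such that $$S(x')\cap W\subset S(x)+\kappa|x'-x|\,\mathbb B\quad\text{for all }x,x'\in\mathcal X\cap V,$$ where $\mathbb B$ is the closed unit ball of $\mathbb R^m$. $S$ has the Aubin property at $\bar x$ for $\bar y$ relative to $\mathcal X$ if its graph is locally closed at $(\bar x,\bar y)$ and some $\kappa\ge0$ is admissible; $\operatorname{lip}_{\mathcal X}S(\bar x\mid\bar y)\in[0,\infty]$ is the infimum of the admissible $\kappa\ge0$. The outer norm of $H$ is $|H|^+=\sup\{|z| : |w|\le 1,\ z\in H(w)\}\in[0,\infty]$. **Proposition (Extended Mordukhovich criterion).** The condition $H(0)=\{0\}$ is equivalent to $$N_{\operatorname{Graph}(S)}(\bar x,\bar y)\cap\bigl(T_{\mathcal X}(\bar x)\times\{0\}\bigr)=\{0\}.$$ If it holds, then $S$ has the Aubin property at $\bar x$ for $\bar y$ relative to $\mathcal X$, and moreover $$\operatorname{lip}_{\mathcal X}S(\bar x\mid\bar y)=|H|^+=\sup\Bigl\{\frac{|u|}{|v|} : (u,v)\in N_{\operatorname{Graph}(S)}(\bar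 x,\bar y)\cap\bigl(T_{\mathcal X}(\bar x)\times\mathbb R^m\bigr)\Bigr\},$$ where $0/0$ is read as $0$ (the condition excludes $v=0$, $u\ne0$). -/

import Mathlib

open Set Filter Topology
open scoped NNReal ENNReal Pointwise

section NormalCones

variable {E : Type*} [NormedAddCommGroup E] [InnerProductSpace ℝ E]

/-- `D` is locally closed at `z`: its intersection with some closed neighbourhood of `z` is
closed. -/
def LocallyClosedAt (D : Set E) (z : E) : Prop :=
  ∃ U ∈ 𝓝 z, IsClosed U ∧ IsClosed (D ∩ U)

/-- The Hadamard (regular) normal cone of `D` at `z`: all `v` with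
`⟪v, z' - z⟫ ≤ o(‖z' - z‖)` for `z' ∈ D`. It is empty at points outside `D`. -/
def hadamardNormalCone (D : Set E) (z : E) : Set E :=
  {v | z ∈ D ∧ ∀ ε : ℝ, 0 < ε → ∀ᶠ z' in 𝓝[D] z, inner ℝ v (z' - z) ≤ ε * ‖z' - z‖}

/-- The limiting normal cone of `D` at `z`: limits of Hadamard normals `v i` at points
`z i ∈ D` converging to `z`. -/
def limitingNormalCone (D : Set E) (z : E) : Set E :=
  {v | ∃ (zs vs : ℕ → E), (∀ i, vs i ∈ hadamardNormalCone D (zs i)) ∧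
    Tendsto zs atTop (𝓝 z) ∧ Tendsto vs atTop (𝓝 v)}

/-- `X` is an (embedded) `C¹` submanifold of dimension `d`: around each of its points there is a
local `C¹` diffeomorphism `φ` of the ambient space which straightens `X` to a linear subspace of
dimension `d`. -/
def IsC1Submanifold (d : ℕ) (X : Set E) : Prop :=
  ∀ x ∈ X, ∃ (φ : OpenPartialHomeomorph E E) (V : Submodule ℝ E),
    x ∈ φ.source ∧ ContDiffOn ℝ 1 φ φ.source ∧ ContDiffOn ℝ 1 φ.symm φ.target ∧
    Module.finrank ℝ V = d ∧ ∀ x' ∈ φ.source, x' ∈ X ↔ φ x' ∈ V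

/-- The tangent space of a `C¹` submanifold `X` at `x`: the velocities at `x` of `C¹` curves
lying in `X` and passing through `x`. -/
def tangentVectors (X : Set E) (x : E) : Set E :=
  {v | ∃ γ : ℝ → E, ContDiffAt ℝ 1 γ 0 ∧ γ 0 = x ∧ (∀ᶠ t in 𝓝 (0 : ℝ), γ t ∈ X) ∧
    HasDerivAt γ v 0}

end NormalCones

section SetValuedMaps

variable {E F : Type*} [NormedAddCommGroup E] [InnerProductSpace ℝ E]
  [NormedAddCommGroup F] [InnerProductSpace ℝ F]

/-- The graph of a set-valued map, inside the product with its Euclidean structure. -/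
def setGraph (S : E → Set F) : Set (WithLp 2 (E × F)) :=
  {z | z.snd ∈ S z.fst}

/-- The limiting coderivative `D*S(x | y) : F ⇉ E`. -/
def limitingCoderivative (S : E → Set F) (x : E) (y : F) : F → Set E :=
  fun ystar => {xstar | WithLp.toLp 2 (xstar, -ystar) ∈
    limitingNormalCone (setGraph S) (WithLp.toLp 2 (x, y))}

/-- The outer norm `|H|⁺` of a (positively homogeneous) set-valued map, with values in
`[0, ∞]`. -/
noncomputable def outerNorm (H : F → Set E) : ℝ≥0∞ :=
  ⨆ w ∈ Metric.closedBall (0 : F) 1, ⨆ z ∈ H w, ‖z‖ₑ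

/-- The Lipschitz-like estimate with constant `κ`, relative to `X`, near `(x₀, u₀)`. -/
def AubinEstimate (S : E → Set F) (X : Set E) (x₀ : E) (u₀ : F) (κ : ℝ≥0) : Prop :=
  ∃ V ∈ 𝓝 x₀, ∃ W ∈ 𝓝 u₀, ∀ x ∈ X ∩ V, ∀ x' ∈ X ∩ V,
    S x' ∩ W ⊆ S x + ((κ : ℝ) * ‖x' - x‖) • Metric.closedBall (0 : F) 1

/-- `S` has the Aubin property relative to `X` at `x₀` for `u₀`. -/
def HasAubinProperty (S : E → Set F) (X : Set E) (x₀ : E) (u₀ : F) : Prop :=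
  x₀ ∈ X ∧ u₀ ∈ S x₀ ∧ LocallyClosedAt (setGraph S) (WithLp.toLp 2 (x₀, u₀)) ∧
    ∃ κ : ℝ≥0, AubinEstimate S X x₀ u₀ κ

/-- The graphical modulus `lip_X S(x₀ | u₀)`, with values in `[0, ∞]` (and `inf ∅ = ∞`). -/
noncomputable def graphicalModulus (S : E → Set F) (X : Set E) (x₀ : E) (u₀ : F) : ℝ≥0∞ :=
  ⨅ (κ : ℝ≥0) (_ : AubinEstimate S X x₀ u₀ κ), (κ : ℝ≥0∞)

/-- The map `H(y*) = D*S(x | y)(y*) ∩ T_X(x)`. -/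
def tangentialCoderivative (S : E → Set F) (X : Set E) (x : E) (y : F) : F → Set E :=
  fun ystar => limitingCoderivative S x y ystar ∩ tangentVectors X x

end SetValuedMaps

/-! ### Limiting normal cones -/

section Cones

variable {E : Type*} [NormedAddCommGroup E] [InnerProductSpace ℝ E]

/-! Everything rests on comparing admissible constants with normals `(u, v)` to the graph whose part
`u` is tangent to `X`.

If `κ` is admissible, then `‖u‖ ≤ κ‖v‖`. A regular normal is tested along a `C¹` curve in `X`, over
which the estimate supplies graph points moving at most `κ` times as fast; the limit is taken with
tangent vectors that vary continuously with the base point (`inner_le_of_aubinEstimate`,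
`norm_fst_le_of_aubinEstimate`).

If `κ` is not admissible and `0 < κ₀ < κ`, a smoothed penalized distance to a point where the
estimate fails attains a minimum on the graph nearby. Its negative gradient there is a regular
normal whose first part has length `κ₀` along a chord of `X`. Chords become tangent in the limit,
which gives a limiting normal with `u` tangent, `‖u‖ = κ₀` and `‖v‖ ≤ 1`
(`exists_normal_of_not_aubinEstimate`).

Hence the modulus equals the outer norm. If no constant were admissible, dividing such normals by
`κ₀ → ∞` would give a limit `(u, 0)` with `‖u‖ = 1`, against the criterion. -/

theorem smul_mem_hadamardNormalCone {D : Set E} {z v : E} {c : ℝ} (hc : 0 < c)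
    (hv : v ∈ hadamardNormalCone D z) : c • v ∈ hadamardNormalCone D z := by
  refine ⟨hv.1, fun ε hε => ?_⟩
  filter_upwards [hv.2 (ε / c) (by positivity)] with z' hz'
  rw [real_inner_smul_left]
  calc c * inner ℝ v (z' - z) ≤ c * (ε / c * ‖z' - z‖) := by gcongr
    _ = ε * ‖z' - z‖ := by field_simp

theorem smul_mem_limitingNormalCone {D : Set E} {z v : E} {c : ℝ} (hc : 0 < c)
    (hv : v ∈ limitingNormalCone D z) : c • v ∈ limitingNormalCone D z := by
  obtain ⟨zs, vs, h, hz, hv⟩ := hv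
  exact ⟨zs, fun i => c • vs i, fun i => smul_mem_hadamardNormalCone hc (h i), hz,
    hv.const_smul c⟩

theorem zero_mem_limitingNormalCone {D : Set E} {z : E} (hz : z ∈ D) :
    0 ∈ limitingNormalCone D z :=
  ⟨fun _ => z, fun _ => 0, fun _ => ⟨hz, fun ε hε => .of_forall fun z' => by
    simpa using by positivity⟩, tendsto_const_nhds, tendsto_const_nhds⟩

/-- The cone is the slice at `z` of the closure of the graph of the regular normal cone. -/
theorem isClosed_limitingNormalCone (D : Set E) (z : E) :
    IsClosed (limitingNormalCone D z) := by
  have h : limitingNormalCone D z =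
      (fun v => (z, v)) ⁻¹' closure {p : E × E | p.2 ∈ hadamardNormalCone D p.1} := by
    ext v
    rw [mem_preimage, mem_closure_iff_seq_limit]
    constructor
    · rintro ⟨zs, vs, h, hz, hv⟩
      exact ⟨fun i => (zs i, vs i), h, hz.prodMk_nhds hv⟩
    · rintro ⟨p, h, hp⟩
      exact ⟨fun i => (p i).1, fun i => (p i).2, h, (continuous_fst.tendsto _).comp hp,
        (continuous_snd.tendsto _).comp hp⟩
  rw [h]
  exact isClosed_closure.preimage (by fun_prop)

end Cones

/-! ### Tangent spaces of `C¹` submanifolds -/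

section Tangent

variable {E : Type*} [NormedAddCommGroup E] [InnerProductSpace ℝ E]

theorem fderiv_symm_apply_fderiv {φ : OpenPartialHomeomorph E E}
    (hφ : ContDiffOn ℝ 1 φ φ.source) (hψ : ContDiffOn ℝ 1 φ.symm φ.target)
    {x : E} (hx : x ∈ φ.source) (v : E) :
    fderiv ℝ φ.symm (φ x) (fderiv ℝ φ x v) = v := by
  have h1 := ((hφ.contDiffAt (φ.open_source.mem_nhds hx)).differentiableAt
    one_ne_zero).hasFDerivAt
  have h2 := ((hψ.contDiffAt (φ.open_target.mem_nhds (φ.map_source hx))).differentiableAt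
    one_ne_zero).hasFDerivAt
  have h3 := (h2.comp x h1).congr_of_eventuallyEq (f₁ := id) (by
    filter_upwards [φ.open_source.mem_nhds hx] with y hy
    simp [φ.left_inv hy])
  simpa using (DFunLike.congr_fun (h3.unique (hasFDerivAt_id x)) v)

variable [FiniteDimensional ℝ E]

theorem mem_tangentVectors_iff {X : Set E} {φ : OpenPartialHomeomorph E E} {V : Submodule ℝ E}
    (hφ : ContDiffOn ℝ 1 φ φ.source) (hψ : ContDiffOn ℝ 1 φ.symm φ.target)
    (hX : ∀ x' ∈ φ.source, x' ∈ X ↔ φ x' ∈ V) {x : E} (hx : x ∈ φ.source) (hxX : x ∈ X)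
    {v : E} : v ∈ tangentVectors X x ↔ fderiv ℝ φ x v ∈ V := by
  have h1 := ((hφ.contDiffAt (φ.open_source.mem_nhds hx)).differentiableAt
    one_ne_zero).hasFDerivAt
  have hψx := hψ.contDiffAt (φ.open_target.mem_nhds (φ.map_source hx))
  have h2 := (hψx.differentiableAt one_ne_zero).hasFDerivAt
  have hxV := (hX x hx).1 hxX
  constructor
  · rintro ⟨γ, -, rfl, hγX, hγ⟩
    have h3 := (hasDerivAt_iff_tendsto_slope_zero.1 (h1.comp_hasDerivAt 0 hγ))
    refine (Submodule.closed_of_finiteDimensional V).mem_of_tendsto h3 ?_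
    refine Filter.Eventually.filter_mono nhdsWithin_le_nhds ?_
    filter_upwards [hγX, hγ.continuousAt.eventually (φ.open_source.mem_nhds hx)] with t ht hts
    simpa using V.smul_mem _ (V.sub_mem ((hX _ hts).1 ht) hxV)
  · intro hv
    have hline : HasDerivAt (fun t : ℝ => φ x + t • fderiv ℝ φ x v) (fderiv ℝ φ x v) 0 := by
      simpa using ((hasDerivAt_id (0 : ℝ)).smul_const (fderiv ℝ φ x v)).const_add (φ x)
    have e0 : φ x + (0 : ℝ) • fderiv ℝ φ x v = φ x := by simp
    refine ⟨fun t => φ.symm (φ x + t • fderiv ℝ φ x v), ?_, by simp [φ.left_inv hx], ?_, ?_⟩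
    · refine ContDiffAt.comp (0 : ℝ) (g := φ.symm)
        (f := fun t : ℝ => φ x + t • fderiv ℝ φ x v) (by rwa [e0]) (by fun_prop)
    · have := hline.continuousAt.eventually_mem
        (φ.open_target.mem_nhds (by rw [e0]; exact φ.map_source hx))
      filter_upwards [this] with t ht
      rw [hX _ (φ.map_target ht), φ.right_inv ht]
      exact V.add_mem hxV (V.smul_mem _ hv)
    · have := HasFDerivAt.comp_hasDerivAt (0 : ℝ) (l := φ.symm) (by rwa [e0]) hline
      rw [fderiv_symm_apply_fderiv hφ hψ hx] at this
      exact this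

theorem IsC1Submanifold.exists_submodule {d : ℕ} {X : Set E} (hX : IsC1Submanifold d X) {x : E}
    (hx : x ∈ X) : ∃ T : Submodule ℝ E, (T : Set E) = tangentVectors X x := by
  obtain ⟨φ, V, hxs, hφ, hψ, -, hV⟩ := hX x hx
  refine ⟨V.comap (fderiv ℝ φ x).toLinearMap, ?_⟩
  ext v
  rw [mem_tangentVectors_iff hφ hψ hV hxs hx]
  simp

/-- Tangent vectors extend continuously to nearby points of the submanifold. -/
theorem IsC1Submanifold.exists_tendsto_tangentVectors {d : ℕ} {X : Set E}
    (hX : IsC1Submanifold d X) {x u : E} (hx : x ∈ X) (hu : u ∈ tangentVectors X x)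
    {xs : ℕ → E} (hxs : Tendsto xs atTop (𝓝 x)) (hxX : ∀ i, xs i ∈ X) :
    ∃ us : ℕ → E, Tendsto us atTop (𝓝 u) ∧ ∀ᶠ i in atTop, us i ∈ tangentVectors X (xs i) := by
  obtain ⟨φ, V, hs, hφ, hψ, -, hV⟩ := hX x hx
  rw [mem_tangentVectors_iff hφ hψ hV hs hx] at hu
  have hψx := hψ.contDiffAt (φ.open_target.mem_nhds (φ.map_source hs))
  -- The straightened vector is kept fixed and pulled back at each nearby point.
  refine ⟨fun i => fderiv ℝ φ.symm (φ (xs i)) (fderiv ℝ φ x u), ?_, ?_⟩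
  · have h1 : Tendsto (fun i => fderiv ℝ φ.symm (φ (xs i))) atTop
        (𝓝 (fderiv ℝ φ.symm (φ x))) :=
      (hψx.fderiv_right (m := 0) (by simp)).continuousAt.tendsto.comp
        ((φ.continuousAt hs).tendsto.comp hxs)
    have h2 := ((ContinuousLinearMap.apply ℝ E (fderiv ℝ φ x u)).continuous.tendsto _).comp h1
    simp only [ContinuousLinearMap.apply_apply] at h2
    rwa [fderiv_symm_apply_fderiv hφ hψ hs] at h2
  · filter_upwards [hxs.eventually_mem (φ.open_source.mem_nhds hs)] with i hi
    rw [mem_tangentVectors_iff hφ hψ hV hi (hxX i)]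
    have := fderiv_symm_apply_fderiv (φ := φ.symm) hψ (by simpa using hφ)
      (x := φ (xs i)) (φ.map_source hi) (fderiv ℝ φ x u)
    rw [φ.symm_symm, φ.left_inv hi] at this
    rwa [this]

/-- Limits of normalized chords of a `C¹` submanifold are tangent vectors. -/
theorem IsC1Submanifold.mem_tangentVectors_of_tendsto {d : ℕ} {X : Set E}
    (hX : IsC1Submanifold d X) {x e : E} (hx : x ∈ X) {as bs : ℕ → E}
    (has : Tendsto as atTop (𝓝 x)) (hbs : Tendsto bs atTop (𝓝 x)) (haX : ∀ i, as i ∈ X)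
    (hbX : ∀ i, bs i ∈ X) (he : Tendsto (fun i => ‖as i - bs i‖⁻¹ • (as i - bs i)) atTop (𝓝 e)) :
    e ∈ tangentVectors X x := by
  obtain ⟨φ, V, hs, hφ, hψ, -, hV⟩ := hX x hx
  rw [mem_tangentVectors_iff hφ hψ hV hs hx]
  -- Both ends of the chord move, so strict differentiability is needed.
  have hst := (hφ.contDiffAt (φ.open_source.mem_nhds hs)).hasStrictFDerivAt one_ne_zero
  have h1 := (hst.isLittleO.comp_tendsto (has.prodMk_nhds hbs)).norm_right.tendsto_inv_smul_nhds_zero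
  have h2 := ((fderiv ℝ φ x).continuous.tendsto e).comp he
  have h3 := h1.add h2
  rw [zero_add] at h3
  refine (Submodule.closed_of_finiteDimensional V).mem_of_tendsto h3 ?_
  filter_upwards [has.eventually_mem (φ.open_source.mem_nhds hs),
    hbs.eventually_mem (φ.open_source.mem_nhds hs)] with i ha hb
  have : ‖as i - bs i‖⁻¹ • (φ (as i) - φ (bs i)) ∈ V :=
    V.smul_mem _ (V.sub_mem ((hV _ ha).1 (haX i)) ((hV _ hb).1 (hbX i)))
  simpa [smul_sub] using this

end Tangent

/-! ### Regular normals from failure of the Aubin estimate, and conversely -/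

theorem norm_withLp_le_add {E F : Type*} [NormedAddCommGroup E] [NormedAddCommGroup F]
    (z : WithLp 2 (E × F)) :
    ‖z‖ ≤ ‖z.fst‖ + ‖z.snd‖ := by
  have := WithLp.prod_norm_sq_eq_of_L2 z
  nlinarith [norm_nonneg z, norm_nonneg z.snd, norm_nonneg z.fst]

section Aubin

variable {E F : Type*} [NormedAddCommGroup E] [InnerProductSpace ℝ E]
  [NormedAddCommGroup F] [InnerProductSpace ℝ F]

/-- With `s` the left side, this is `2cs ≤ c² + s²` divided by `2c`. Taking `δ = 0` gives the same
quadratic bound for the norm itself away from the origin. -/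
theorem sqrt_norm_sq_add_sq_le (a b : E) (δ : ℝ) {c : ℝ} (hc : 0 < c)
    (hca : c ^ 2 = ‖a‖ ^ 2 + δ ^ 2) :
    √(‖b‖ ^ 2 + δ ^ 2) ≤ c + inner ℝ (c⁻¹ • a) (b - a) + (2 * c)⁻¹ * ‖b - a‖ ^ 2 := by
  have hT : ‖b‖ ^ 2 + δ ^ 2 = c ^ 2 + 2 * inner ℝ a (b - a) + ‖b - a‖ ^ 2 := by
    have := norm_add_sq_real a (b - a)
    rw [add_sub_cancel] at this
    linarith
  have hs := Real.sq_sqrt (show 0 ≤ ‖b‖ ^ 2 + δ ^ 2 by positivity)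
  rw [real_inner_smul_left]
  have key : 2 * c * √(‖b‖ ^ 2 + δ ^ 2) ≤ 2 * c ^ 2 + 2 * inner ℝ a (b - a) + ‖b - a‖ ^ 2 := by
    nlinarith [sq_nonneg (√(‖b‖ ^ 2 + δ ^ 2) - c)]
  have : c + c⁻¹ * inner ℝ a (b - a) + (2 * c)⁻¹ * ‖b - a‖ ^ 2 =
      (2 * c ^ 2 + 2 * inner ℝ a (b - a) + ‖b - a‖ ^ 2) / (2 * c) := by
    field_simp
  rw [this, le_div_iff₀ (by positivity)]
  linarith

/-- Fermat's rule: the objective exceeds its linearization at `z` by at most `C‖z' - z‖²`, so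
minimality bounds the negative gradient's pairing by a term of second order. The condition `z.fst ≠
x` keeps the norm differentiable. -/
theorem neg_gradient_mem_hadamardNormalCone {D : Set (WithLp 2 (E × F))}
    {z : WithLp 2 (E × F)} (hz : z ∈ D) {x : E} {y : F} {κ δ : ℝ} (hκ : 0 < κ) (hδ : 0 < δ)
    (hzx : z.fst ≠ x)
    (hmin : ∀ᶠ z' in 𝓝[D] z, κ * ‖z.fst - x‖ + √(‖z.snd - y‖ ^ 2 + δ ^ 2) ≤
      κ * ‖z'.fst - x‖ + √(‖z'.snd - y‖ ^ 2 + δ ^ 2)) :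
    WithLp.toLp 2 (-(κ • ‖z.fst - x‖⁻¹ • (z.fst - x)),
      -((√(‖z.snd - y‖ ^ 2 + δ ^ 2))⁻¹ • (z.snd - y))) ∈ hadamardNormalCone D z := by
  refine ⟨hz, fun ε hε => ?_⟩
  set r := ‖z.fst - x‖ with hr
  set c := √(‖z.snd - y‖ ^ 2 + δ ^ 2) with hc
  have hr0 : 0 < r := norm_pos_iff.2 (sub_ne_zero.2 hzx)
  have hc0 : 0 < c := Real.sqrt_pos.2 (by positivity)
  have hc2 : c ^ 2 = ‖z.snd - y‖ ^ 2 + δ ^ 2 := Real.sq_sqrt (by positivity)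
  set C := κ * (2 * r)⁻¹ + (2 * c)⁻¹ with hC
  have hC0 : 0 < C := by positivity
  have hnear : ∀ᶠ z' in 𝓝[D] z, ‖z' - z‖ < ε / C := by
    filter_upwards [nhdsWithin_le_nhds (Metric.ball_mem_nhds z (div_pos hε hC0))] with z' h
    rwa [← dist_eq_norm]
  filter_upwards [hmin, hnear] with z' h1 h2
  have hx := sqrt_norm_sq_add_sq_le (z.fst - x) (z'.fst - x) 0 hr0 (by rw [hr]; ring)
  have hy := sqrt_norm_sq_add_sq_le (z.snd - y) (z'.snd - y) δ hc0 hc2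
  rw [zero_pow two_ne_zero, add_zero, Real.sqrt_sq (norm_nonneg _), sub_sub_sub_cancel_right]
    at hx
  rw [sub_sub_sub_cancel_right] at hy
  have hx2 : ‖z'.fst - z.fst‖ ≤ ‖z' - z‖ := WithLp.norm_fst_le _ (z' - z)
  have hy2 : ‖z'.snd - z.snd‖ ≤ ‖z' - z‖ := WithLp.norm_snd_le _ (z' - z)
  have hx3 : κ * ‖z'.fst - x‖ ≤ κ * (r + inner ℝ (r⁻¹ • (z.fst - x)) (z'.fst - z.fst)
      + (2 * r)⁻¹ * ‖z' - z‖ ^ 2) := by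
    refine mul_le_mul_of_nonneg_left (hx.trans ?_) hκ.le
    gcongr
  have hy3 : √(‖z'.snd - y‖ ^ 2 + δ ^ 2) ≤ c + inner ℝ (c⁻¹ • (z.snd - y)) (z'.snd - z.snd)
      + (2 * c)⁻¹ * ‖z' - z‖ ^ 2 := by
    refine hy.trans ?_
    gcongr
  have hfin : C * ‖z' - z‖ ^ 2 ≤ ε * ‖z' - z‖ := by
    rw [lt_div_iff₀ hC0] at h2
    nlinarith [norm_nonneg (z' - z)]
  rw [WithLp.prod_inner_apply]
  change inner ℝ (-(κ • r⁻¹ • (z.fst - x))) (z'.fst - z.fst) +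
    inner ℝ (-(c⁻¹ • (z.snd - y))) (z'.snd - z.snd) ≤ _
  rw [inner_neg_left, inner_neg_left, real_inner_smul_left (r⁻¹ • (z.fst - x))]
  rw [hC] at hfin
  linarith

theorem inner_le_of_aubinEstimate {S : E → Set F} {X : Set E} {V : Set E} {W : Set F} {κ : ℝ}
    (hκ : 0 ≤ κ)
    (h : ∀ x ∈ X ∩ V, ∀ x' ∈ X ∩ V,
      S x' ∩ W ⊆ S x + (κ * ‖x' - x‖) • Metric.closedBall (0 : F) 1)
    {z w : WithLp 2 (E × F)} (hzX : z.fst ∈ X) (hzV : V ∈ 𝓝 z.fst) (hzW : z.snd ∈ W)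
    (hw : w ∈ hadamardNormalCone (setGraph S) z) {u : E} (hu : u ∈ tangentVectors X z.fst) :
    inner ℝ w.fst u ≤ κ * ‖w.snd‖ * ‖u‖ := by
  obtain ⟨γ, hγ1, hγ0, hγX, hγ⟩ := hu
  have hγc : Tendsto γ (𝓝 0) (𝓝 z.fst) := by simpa [hγ0] using hγ.continuousAt.tendsto
  have hy : ∀ᶠ t in 𝓝 (0 : ℝ), ∃ y ∈ S (γ t), ‖y - z.snd‖ ≤ κ * ‖γ t - z.fst‖ := by
    filter_upwards [hγX, hγc.eventually hzV] with t htX htV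
    obtain ⟨y, hy, q, ⟨b, hb, rfl⟩, hyq⟩ := h (γ t) ⟨htX, htV⟩ z.fst
      ⟨hzX, mem_of_mem_nhds hzV⟩ ⟨hw.1, hzW⟩
    refine ⟨y, hy, ?_⟩
    have hyq : y + (κ * ‖z.fst - γ t‖) • b = z.snd := hyq
    rw [← hyq, sub_add_cancel_left, norm_neg, norm_smul, Real.norm_of_nonneg (by positivity),
      norm_sub_rev]
    exact mul_le_of_le_one_right (by positivity) (by simpa using hb)
  -- Selecting for every `t`, with the junk value `0` where no such point exists, makes `y` a
  -- function on all of `ℝ`.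
  have hy' : ∀ t : ℝ, ∃ y, (∃ y ∈ S (γ t), ‖y - z.snd‖ ≤ κ * ‖γ t - z.fst‖) →
      y ∈ S (γ t) ∧ ‖y - z.snd‖ ≤ κ * ‖γ t - z.fst‖ := fun t => by
    by_cases hq : ∃ y ∈ S (γ t), ‖y - z.snd‖ ≤ κ * ‖γ t - z.fst‖
    · exact ⟨hq.choose, fun _ => hq.choose_spec⟩
    · exact ⟨0, fun h => absurd h hq⟩
  choose y hyspec using hy'
  replace hy := hy.mono fun t ht => hyspec t ht
  have hzt : Tendsto (fun t => WithLp.toLp 2 (γ t, y t)) (𝓝 0) (𝓝[setGraph S] z) := by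
    refine tendsto_nhdsWithin_iff.2 ⟨?_, hy.mono fun t ht => ht.1⟩
    have h0 : Tendsto (fun t => (1 + κ) * ‖γ t - z.fst‖) (𝓝 0) (𝓝 0) := by
      have := ((hγc.sub_const z.fst).norm).const_mul (1 + κ)
      simpa using this
    rw [tendsto_iff_norm_sub_tendsto_zero]
    refine squeeze_zero' (.of_forall fun _ => norm_nonneg _) (hy.mono fun t ht => ?_) h0
    refine (norm_withLp_le_add _).trans ?_
    have h1 : ‖y t - z.snd‖ ≤ κ * ‖γ t - z.fst‖ := ht.2
    change ‖γ t - z.fst‖ + ‖y t - z.snd‖ ≤ _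
    linarith
  have hslope := hasDerivAt_iff_tendsto_slope_zero.1 hγ
  have hslope : Tendsto (fun t : ℝ => t⁻¹ • (γ t - z.fst)) (𝓝[>] 0) (𝓝 u) := by
    simpa [hγ0] using hslope.mono_left (nhdsWithin_mono _ (s := Ioi 0) fun t ht => ne_of_gt ht)
  -- The factor `1 + κ` bounds the graph displacement by that of `γ`.
  have hε : ∀ ε : ℝ, 0 < ε → inner ℝ w.fst u ≤ (κ * ‖w.snd‖ + ε * (1 + κ)) * ‖u‖ := by
    intro ε hε
    refine le_of_tendsto_of_tendsto (tendsto_const_nhds.inner hslope)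
      (hslope.norm.const_mul _) ?_
    filter_upwards [(hy.and (hzt.eventually (hw.2 ε hε))).filter_mono nhdsWithin_le_nhds,
      self_mem_nhdsWithin] with t ht ht0
    obtain ⟨⟨-, hty⟩, htw⟩ := ht
    have ht0 : 0 < t := ht0
    rw [WithLp.prod_inner_apply] at htw
    have hn : ‖WithLp.toLp 2 (γ t, y t) - z‖ ≤ ‖γ t - z.fst‖ + ‖y t - z.snd‖ :=
      norm_withLp_le_add _
    have hv : -(‖w.snd‖ * ‖y t - z.snd‖) ≤ inner ℝ w.snd (y t - z.snd) :=
      neg_le_of_abs_le (abs_real_inner_le_norm _ _)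
    have h1 : ‖w.snd‖ * ‖y t - z.snd‖ ≤ ‖w.snd‖ * (κ * ‖γ t - z.fst‖) := by gcongr
    have h2 : ε * ‖WithLp.toLp 2 (γ t, y t) - z‖ ≤
        ε * (‖γ t - z.fst‖ + κ * ‖γ t - z.fst‖) := by
      gcongr; linarith
    rw [real_inner_smul_right, norm_smul, Real.norm_of_nonneg (by positivity)]
    calc t⁻¹ * inner ℝ w.fst (γ t - z.fst)
        ≤ t⁻¹ * ((κ * ‖w.snd‖ + ε * (1 + κ)) * ‖γ t - z.fst‖) := by
          gcongr
          have htw' : inner ℝ w.fst (γ t - z.fst) + inner ℝ w.snd (y t - z.snd) ≤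
            ε * ‖WithLp.toLp 2 (γ t, y t) - z‖ := htw
          linarith
      _ = _ := by ring
  refine le_of_forall_pos_le_add fun η hη => ?_
  -- The `+ 1` guards against `u = 0`.
  have := hε (η / ((1 + κ) * (‖u‖ + 1))) (by positivity)
  refine this.trans ?_
  rw [add_mul]
  gcongr
  rw [div_mul_eq_mul_div, div_mul_eq_mul_div, div_le_iff₀ (by positivity)]
  nlinarith [norm_nonneg u, mul_nonneg hη.le (show 0 ≤ 1 + κ by positivity)]

variable [FiniteDimensional ℝ E] [FiniteDimensional ℝ F]

/-- If the Aubin estimate fails with constant `κ > κ₀`, then arbitrarily close to the reference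
point the graph has regular normals `(-κ₀ e, v)` with `‖v‖ ≤ 1` and `e` a normalized chord. -/
theorem exists_regular_normal_of_not_aubinEstimate {S : E → Set F} {X : Set E} {x₀ : E} {y₀ : F}
    (hclosed : LocallyClosedAt (setGraph S) (WithLp.toLp 2 (x₀, y₀)))
    {κ : ℝ≥0} {κ₀ : ℝ} (hκ₀ : 0 < κ₀) (hκ : κ₀ < κ) (h : ¬ AubinEstimate S X x₀ y₀ κ)
    {ε : ℝ} (hε : 0 < ε) :
    ∃ z ∈ setGraph S, ∃ x ∈ X, ∃ v : F, ‖z - WithLp.toLp 2 (x₀, y₀)‖ < ε ∧ ‖x - x₀‖ < ε ∧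
      z.fst ≠ x ∧ ‖v‖ ≤ 1 ∧ WithLp.toLp 2 (-(κ₀ • ‖z.fst - x‖⁻¹ • (z.fst - x)), v) ∈
        hadamardNormalCone (setGraph S) z := by
  obtain ⟨U, hU, -, hUc⟩ := hclosed
  set p₀ := WithLp.toLp 2 (x₀, y₀) with hp₀
  obtain ⟨R, hR, hRU⟩ := Metric.nhds_basis_closedBall.mem_iff.1 hU
  set D := setGraph S
  have hcomp : IsCompact (D ∩ Metric.closedBall p₀ R) := by
    have : D ∩ Metric.closedBall p₀ R = (D ∩ U) ∩ Metric.closedBall p₀ R := by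
      rw [inter_assoc, inter_eq_right.2 hRU]
    rw [this]
    have : FiniteDimensional ℝ (WithLp 2 (E × F)) :=
      (WithLp.linearEquiv 2 ℝ (E × F)).symm.finiteDimensional
    have : ProperSpace (WithLp 2 (E × F)) := FiniteDimensional.proper ℝ _
    exact (isCompact_closedBall p₀ R).inter_left hUc
  set ρ := min ε R with hρ
  have hρ0 : 0 < ρ := lt_min hε hR
  -- The total drift from `p₀` will be below `(2s + s) + (2κs + s) = ρ`.
  set s := ρ / (4 + 2 * (κ : ℝ)) with hs
  have hκ0 : (0 : ℝ) < κ := hκ₀.trans hκ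
  have hs0 : 0 < s := by positivity
  have hsρ : s * (4 + 2 * (κ : ℝ)) = ρ := by rw [hs]; field_simp
  have : ∃ x ∈ X, ‖x - x₀‖ < s ∧ ∃ x' ∈ X, ‖x' - x₀‖ < s ∧ ∃ y ∈ S x', ‖y - y₀‖ < s ∧
      y ∉ S x + ((κ : ℝ) * ‖x' - x‖) • Metric.closedBall (0 : F) 1 := by
    by_contra! hcon
    refine h ⟨Metric.ball x₀ s, Metric.ball_mem_nhds _ hs0, Metric.ball y₀ s,
      Metric.ball_mem_nhds _ hs0, ?_⟩
    rintro x ⟨hxX, hx⟩ x' ⟨hxX', hx'⟩ y ⟨hy, hyW⟩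
    rw [mem_ball_iff_norm] at hx hx' hyW
    exact hcon x hxX hx x' hxX' hx' y hy hyW
  obtain ⟨x, hxX, hx, x', hxX', hx', y, hy, hyW, hyn⟩ := this
  have hxx' : x' ≠ x := by
    rintro rfl
    exact hyn ⟨y, hy, 0, ⟨0, by simp, by simp⟩, add_zero y⟩
  set a := ‖x' - x‖ with ha
  have ha0 : 0 < a := norm_pos_iff.2 (sub_ne_zero.2 hxx')
  have has : a < 2 * s := by
    have := norm_sub_le (x' - x₀) (x - x₀)
    rw [sub_sub_sub_cancel_right] at this
    linarith
  have hfar : ∀ y' ∈ S x, κ * a < ‖y' - y‖ := by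
    intro y' hy'
    by_contra! hcon
    refine hyn ⟨y', hy', y - y', ⟨((κ : ℝ) * a)⁻¹ • (y - y'), ?_, ?_⟩, add_sub_cancel y' y⟩
    · rw [mem_closedBall_zero_iff, norm_smul, Real.norm_of_nonneg (by positivity),
        inv_mul_le_iff₀ (by positivity), norm_sub_rev]
      linarith
    · exact smul_inv_smul₀ (by positivity) _
  -- Chosen so that the objective equals `κ₀ a + δ = κ a` at `(x', y)`.
  set δ := (κ - κ₀) * a with hδ
  have hδ0 : 0 < δ := mul_pos (sub_pos.2 hκ) ha0
  set f : WithLp 2 (E × F) → ℝ := fun z => κ₀ * ‖z.fst - x‖ + √(‖z.snd - y‖ ^ 2 + δ ^ 2) with hf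
  have hclose : ∀ z : WithLp 2 (E × F), ‖z.fst - x‖ ≤ a → ‖z.snd - y‖ ≤ κ * a →
      ‖z - p₀‖ < ρ := by
    intro z h1 h2
    have e1 : ‖z.fst - x₀‖ ≤ ‖z.fst - x‖ + ‖x - x₀‖ := norm_sub_le_norm_sub_add_norm_sub _ _ _
    have e2 : ‖z.snd - y₀‖ ≤ ‖z.snd - y‖ + ‖y - y₀‖ := norm_sub_le_norm_sub_add_norm_sub _ _ _
    have e3 : ‖z - p₀‖ ≤ ‖z.fst - x₀‖ + ‖z.snd - y₀‖ := norm_withLp_le_add _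
    have : (κ : ℝ) * a ≤ κ * (2 * s) := by gcongr
    linarith
  have hp : WithLp.toLp 2 (x', y) ∈ D ∩ Metric.closedBall p₀ R := by
    refine ⟨hy, ?_⟩
    rw [mem_closedBall_iff_norm]
    exact ((hclose _ le_rfl (by simpa using by positivity)).trans_le (min_le_right _ _)).le
  have hfc : Continuous f := by
    have h1 : Continuous fun z : WithLp 2 (E × F) => z.fst := by fun_prop
    have h2 : Continuous fun z : WithLp 2 (E × F) => z.snd := by fun_prop
    fun_prop
  obtain ⟨z, hz, hzmin⟩ := hcomp.exists_isMinOn ⟨_, hp⟩ hfc.continuousOn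
  have hfp : f z ≤ κ * a := by
    have : f (WithLp.toLp 2 (x', y)) = κ * a := by
      change κ₀ * ‖x' - x‖ + √(‖y - y‖ ^ 2 + δ ^ 2) = κ * a
      rw [sub_self, norm_zero, zero_pow two_ne_zero, zero_add, Real.sqrt_sq hδ0.le, hδ]
      ring
    exact this ▸ hzmin hp
  have hb1 : δ ≤ √(‖z.snd - y‖ ^ 2 + δ ^ 2) :=
    Real.le_sqrt_of_sq_le (by nlinarith [sq_nonneg ‖z.snd - y‖])
  have hb2 : ‖z.snd - y‖ ≤ √(‖z.snd - y‖ ^ 2 + δ ^ 2) :=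
    Real.le_sqrt_of_sq_le (by nlinarith [sq_nonneg δ])
  have hfz : κ₀ * ‖z.fst - x‖ + √(‖z.snd - y‖ ^ 2 + δ ^ 2) ≤ κ * a := hfp
  have hc1 : ‖z.fst - x‖ ≤ a := by
    refine le_of_mul_le_mul_left (a := κ₀) ?_ hκ₀
    linarith
  have hc2 : ‖z.snd - y‖ ≤ κ * a := by
    nlinarith [norm_nonneg (z.fst - x)]
  have hzρ := hclose z hc1 hc2
  -- A minimizer over `x` would be a point of `S x` within `κ a` of `y`.
  have hzx : z.fst ≠ x := by
    rintro rfl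
    exact absurd (hfar z.snd hz.1) (not_lt.2 hc2)
  refine ⟨z, hz.1, x, hxX, _, hzρ.trans_le (min_le_left _ _), ?_, hzx, ?_,
    neg_gradient_mem_hadamardNormalCone hz.1 (y := y) hκ₀ hδ0 hzx ?_⟩
  · refine hx.trans_le ((?_ : s ≤ ρ).trans (min_le_left _ _))
    nlinarith
  · rw [norm_neg, norm_smul, Real.norm_of_nonneg (by positivity),
      inv_mul_le_iff₀ (hδ0.trans_le hb1), mul_one]
    exact hb2
  -- The minimizer is interior to the ball, hence a local minimizer on the whole graph.
  · have hball : Metric.ball p₀ R ∈ 𝓝 z :=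
      Metric.isOpen_ball.mem_nhds (by
        rw [mem_ball_iff_norm]; exact hzρ.trans_le (min_le_right _ _))
    filter_upwards [self_mem_nhdsWithin, nhdsWithin_le_nhds hball] with z' h1 h2
    exact hzmin ⟨h1, Metric.ball_subset_closedBall h2⟩

end Aubin

/-! ### The extended Mordukhovich criterion -/

section Criterion

variable {E F : Type*} [NormedAddCommGroup E] [InnerProductSpace ℝ E]
  [NormedAddCommGroup F] [InnerProductSpace ℝ F]

theorem zero_mem_tangentVectors {X : Set E} {x : E} (hx : x ∈ X) : 0 ∈ tangentVectors X x :=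
  ⟨fun _ => x, contDiffAt_const, rfl, .of_forall fun _ => hx, hasDerivAt_const _ _⟩

theorem fst_mem_limitingCoderivative {S : E → Set F} {x : E} {y : F} {w : WithLp 2 (E × F)}
    (hw : w ∈ limitingNormalCone (setGraph S) (WithLp.toLp 2 (x, y))) :
    w.fst ∈ limitingCoderivative S x y (-w.snd) := by
  change WithLp.toLp 2 (w.fst, - -w.snd) ∈ limitingNormalCone _ _
  rwa [neg_neg]

theorem tangentialCoderivative_zero_eq_iff {S : E → Set F} {X : Set E} {x₀ : E} {y₀ : F}
    (hx : x₀ ∈ X) (hmem : y₀ ∈ S x₀) :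
    tangentialCoderivative S X x₀ y₀ 0 = {0} ↔
      ∀ w ∈ limitingNormalCone (setGraph S) (WithLp.toLp 2 (x₀, y₀)),
        w.fst ∈ tangentVectors X x₀ → w.snd = 0 → w.fst = 0 := by
  have hN := zero_mem_limitingNormalCone (D := setGraph S) (z := WithLp.toLp 2 (x₀, y₀)) hmem
  constructor
  · intro h w hw hwT hw0
    have : w.fst ∈ tangentialCoderivative S X x₀ y₀ 0 := by
      have := fst_mem_limitingCoderivative hw
      rw [hw0, neg_zero] at this
      exact ⟨this, hwT⟩
    rwa [h] at this
  · intro h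
    refine Subset.antisymm (fun u hu => h _ hu.1 hu.2 neg_zero) ?_
    rintro _ rfl
    have := fst_mem_limitingCoderivative hN
    rw [WithLp.zero_snd, neg_zero] at this
    exact ⟨this, zero_mem_tangentVectors hx⟩

theorem limitingNormalCone_inter_eq_iff {S : E → Set F} {X : Set E} {x₀ : E} {y₀ : F}
    (hx : x₀ ∈ X) (hmem : y₀ ∈ S x₀) :
    limitingNormalCone (setGraph S) (WithLp.toLp 2 (x₀, y₀)) ∩
        {w | w.fst ∈ tangentVectors X x₀ ∧ w.snd = 0} = {0} ↔
      ∀ w ∈ limitingNormalCone (setGraph S) (WithLp.toLp 2 (x₀, y₀)),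
        w.fst ∈ tangentVectors X x₀ → w.snd = 0 → w.fst = 0 := by
  have hN := zero_mem_limitingNormalCone (D := setGraph S) (z := WithLp.toLp 2 (x₀, y₀)) hmem
  constructor
  · intro h w hw hwT hw0
    have : w = 0 := h.subset ⟨hw, hwT, hw0⟩
    rw [this, WithLp.zero_fst]
  · intro h
    refine Subset.antisymm (fun w hw => ?_) ?_
    · have := h w hw.1 hw.2.1 hw.2.2
      exact (WithLp.ofLp_injective 2) (Prod.ext this hw.2.2)
    · rintro _ rfl
      exact ⟨hN, zero_mem_tangentVectors hx, rfl⟩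

variable [FiniteDimensional ℝ E]

theorem norm_fst_le_of_aubinEstimate {d : ℕ} {X : Set E} (hX : IsC1Submanifold d X)
    {S : E → Set F} (hS : ∀ x, x ∉ X → S x = ∅) {x₀ : E} {y₀ : F} (hmem : y₀ ∈ S x₀)
    {κ : ℝ≥0} (h : AubinEstimate S X x₀ y₀ κ) {w : WithLp 2 (E × F)}
    (hw : w ∈ limitingNormalCone (setGraph S) (WithLp.toLp 2 (x₀, y₀)))
    (hwT : w.fst ∈ tangentVectors X x₀) : ‖w.fst‖ ≤ κ * ‖w.snd‖ := by
  have hSX : ∀ {x y}, y ∈ S x → x ∈ X := fun {x y} hy => by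
    by_contra hx
    simp [hS x hx] at hy
  obtain ⟨zs, ws, hN, hz, hws⟩ := hw
  obtain ⟨V, hV, W, hW, hVW⟩ := h
  have hf := WithLp.continuous_fst 2 E F
  have hs := WithLp.continuous_snd 2 E F
  have hz1 : Tendsto (fun i => (zs i).fst) atTop (𝓝 x₀) :=
    (hf.tendsto (WithLp.toLp 2 (x₀, y₀))).comp hz
  have hz2 : Tendsto (fun i => (zs i).snd) atTop (𝓝 y₀) :=
    (hs.tendsto (WithLp.toLp 2 (x₀, y₀))).comp hz
  have hw1 : Tendsto (fun i => (ws i).fst) atTop (𝓝 w.fst) := (hf.tendsto w).comp hws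
  have hw2 : Tendsto (fun i => (ws i).snd) atTop (𝓝 w.snd) := (hs.tendsto w).comp hws
  -- The approximating normals need not have tangent first parts, so they are paired with tangent
  -- vectors converging to `w.fst`.
  obtain ⟨us, hus, husT⟩ := hX.exists_tendsto_tangentVectors (hSX hmem) hwT hz1
    (fun i => hSX (hN i).1)
  have key : inner ℝ w.fst w.fst ≤ κ * ‖w.snd‖ * ‖w.fst‖ := by
    refine le_of_tendsto_of_tendsto (hw1.inner hus) ((hw2.norm.const_mul _).mul hus.norm) ?_
    filter_upwards [husT, hz1.eventually (eventually_mem_nhds_iff.2 hV),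
      hz2.eventually_mem hW] with i hi hiV hiW
    exact inner_le_of_aubinEstimate κ.2 hVW (hSX (hN i).1) hiV hiW (hN i) hi
  rw [real_inner_self_eq_norm_mul_norm] at key
  rcases (norm_nonneg w.fst).eq_or_lt with h0 | h0
  · rw [← h0]; positivity
  · exact le_of_mul_le_mul_right key h0

/-- The quotient is invariant under positive scaling, so `v` may be normalized to length one. -/
theorem outerNorm_tangentialCoderivative_eq {d : ℕ} {X : Set E} (hX : IsC1Submanifold d X)
    {S : E → Set F} {x₀ : E} {y₀ : F} (hx : x₀ ∈ X)
    (hcrit : ∀ w ∈ limitingNormalCone (setGraph S) (WithLp.toLp 2 (x₀, y₀)),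
      w.fst ∈ tangentVectors X x₀ → w.snd = 0 → w.fst = 0) :
    outerNorm (tangentialCoderivative S X x₀ y₀) =
      ⨆ w ∈ limitingNormalCone (setGraph S) (WithLp.toLp 2 (x₀, y₀)) ∩
        {w | w.fst ∈ tangentVectors X x₀}, ‖w.fst‖ₑ / ‖w.snd‖ₑ := by
  apply le_antisymm
  · refine iSup₂_le fun w hw => iSup₂_le fun z hz => ?_
    refine le_iSup₂_of_le (WithLp.toLp 2 (z, -w)) ⟨hz.1, hz.2⟩ ?_
    change ‖z‖ₑ ≤ ‖z‖ₑ / ‖-w‖ₑ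
    have hw1 : ‖w‖ₑ ≤ 1 := by
      rw [enorm_eq_nnnorm]
      exact_mod_cast mem_closedBall_zero_iff.1 hw
    rw [enorm_neg]
    calc ‖z‖ₑ = ‖z‖ₑ / 1 := (div_one _).symm
      _ ≤ ‖z‖ₑ / ‖w‖ₑ := ENNReal.div_le_div_left hw1 _
  · refine iSup₂_le fun w hw => ?_
    -- Here the criterion forces `u = 0`, and `0 / 0 = 0` in `ℝ≥0∞`.
    by_cases hw0 : w.snd = 0
    · simp [hcrit w hw.1 hw.2 hw0]
    obtain ⟨T, hT⟩ := hX.exists_submodule hx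
    have hn : 0 < ‖w.snd‖ := norm_pos_iff.2 hw0
    have hz : ‖w.snd‖⁻¹ • w.fst ∈
        tangentialCoderivative S X x₀ y₀ (-(‖w.snd‖⁻¹ • w.snd)) := by
      constructor
      · exact fst_mem_limitingCoderivative (smul_mem_limitingNormalCone (inv_pos.2 hn) hw.1)
      · rw [← hT]
        exact T.smul_mem _ (show w.fst ∈ (T : Set E) from hT ▸ hw.2)
    refine le_iSup₂_of_le (-(‖w.snd‖⁻¹ • w.snd)) ?_ (le_iSup₂_of_le _ hz ?_)
    · rw [mem_closedBall_zero_iff, norm_neg]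
      exact (norm_smul_inv_norm (𝕜 := ℝ) hw0).le
    · rw [enorm_smul, enorm_inv hn.ne', enorm_norm, mul_comm, div_eq_mul_inv]

variable [FiniteDimensional ℝ F]

theorem exists_normal_of_not_aubinEstimate {d : ℕ} {X : Set E} (hX : IsC1Submanifold d X)
    {S : E → Set F} (hS : ∀ x, x ∉ X → S x = ∅) {x₀ : E} {y₀ : F} (hmem : y₀ ∈ S x₀)
    (hclosed : LocallyClosedAt (setGraph S) (WithLp.toLp 2 (x₀, y₀)))
    {κ : ℝ≥0} {κ₀ : ℝ} (hκ₀ : 0 < κ₀) (hκ : κ₀ < κ) (h : ¬ AubinEstimate S X x₀ y₀ κ) :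
    ∃ w ∈ limitingNormalCone (setGraph S) (WithLp.toLp 2 (x₀, y₀)),
      w.fst ∈ tangentVectors X x₀ ∧ ‖w.fst‖ = κ₀ ∧ ‖w.snd‖ ≤ 1 := by
  have hSX : ∀ {x y}, y ∈ S x → x ∈ X := fun {x y} hy => by
    by_contra hx
    simp [hS x hx] at hy
  choose z hz x hx v hzε hxε hne hv hN using fun k : ℕ =>
    exists_regular_normal_of_not_aubinEstimate hclosed hκ₀ hκ h (Nat.one_div_pos_of_nat (n := k))
  have h0 : Tendsto (fun k : ℕ => 1 / ((k : ℝ) + 1)) atTop (𝓝 0) :=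
    tendsto_one_div_add_atTop_nhds_zero_nat
  have hzt : Tendsto z atTop (𝓝 (WithLp.toLp 2 (x₀, y₀))) :=
    tendsto_iff_norm_sub_tendsto_zero.2
      (squeeze_zero (fun _ => norm_nonneg _) (fun k => (hzε k).le) h0)
  have hxt : Tendsto x atTop (𝓝 x₀) :=
    tendsto_iff_norm_sub_tendsto_zero.2
      (squeeze_zero (fun _ => norm_nonneg _) (fun k => (hxε k).le) h0)
  have hzt' : Tendsto (fun k => (z k).fst) atTop (𝓝 x₀) :=
    ((WithLp.continuous_fst 2 E F).tendsto (WithLp.toLp 2 (x₀, y₀))).comp hzt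
  obtain ⟨⟨e, v'⟩, ⟨he, hv'⟩, θ, hθ, hlim⟩ :=
    ((isCompact_sphere (0 : E) 1).prod (isCompact_closedBall (0 : F) 1)).tendsto_subseq
      (x := fun k => (‖(z k).fst - x k‖⁻¹ • ((z k).fst - x k), v k)) (fun k => by
        refine ⟨?_, by simpa using hv k⟩
        rw [mem_sphere_zero_iff_norm]
        exact norm_smul_inv_norm (𝕜 := ℝ) (sub_ne_zero.2 (hne k)))
  rw [mem_sphere_zero_iff_norm] at he
  have hle : Tendsto (fun k => ‖(z (θ k)).fst - x (θ k)‖⁻¹ • ((z (θ k)).fst - x (θ k)))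
      atTop (𝓝 e) := (continuous_fst.tendsto (e, v')).comp hlim
  have hlv : Tendsto (fun k => v (θ k)) atTop (𝓝 v') := (continuous_snd.tendsto (e, v')).comp hlim
  have hθt := hθ.tendsto_atTop
  have heT : e ∈ tangentVectors X x₀ :=
    hX.mem_tangentVectors_of_tendsto (hSX hmem) (hzt'.comp hθt) (hxt.comp hθt)
      (fun k => hSX (hz (θ k))) (fun k => hx (θ k)) hle
  obtain ⟨T, hT⟩ := hX.exists_submodule (hSX hmem)
  refine ⟨WithLp.toLp 2 (-(κ₀ • e), v'), ⟨z ∘ θ, _, fun k => hN (θ k), hzt.comp hθt, ?_⟩,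
    ?_, ?_, by simpa using hv'⟩
  · exact ((WithLp.prod_continuous_toLp 2 E F).tendsto _).comp
      ((hle.const_smul κ₀).neg.prodMk_nhds hlv)
  · rw [← hT] at heT ⊢
    exact T.neg_mem (T.smul_mem _ heT)
  · change ‖-(κ₀ • e)‖ = κ₀
    rw [norm_neg, norm_smul, he, mul_one, Real.norm_of_nonneg hκ₀.le]

theorem exists_aubinEstimate {d : ℕ} {X : Set E} (hX : IsC1Submanifold d X)
    {S : E → Set F} (hS : ∀ x, x ∉ X → S x = ∅) {x₀ : E} {y₀ : F} (hmem : y₀ ∈ S x₀)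
    (hclosed : LocallyClosedAt (setGraph S) (WithLp.toLp 2 (x₀, y₀)))
    (hcrit : ∀ w ∈ limitingNormalCone (setGraph S) (WithLp.toLp 2 (x₀, y₀)),
      w.fst ∈ tangentVectors X x₀ → w.snd = 0 → w.fst = 0) :
    ∃ κ : ℝ≥0, AubinEstimate S X x₀ y₀ κ := by
  by_contra! hcon
  have hxX : x₀ ∈ X := by
    by_contra hx
    simp [hS x₀ hx] at hmem
  obtain ⟨T, hT⟩ := hX.exists_submodule hxX
  -- First parts have length `k + 1` while second parts stay in the unit ball, so rescaling by `(k +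
  -- 1)⁻¹` kills the latter.
  choose w hwN hwT hw1 hw2 using fun k : ℕ =>
    exists_normal_of_not_aubinEstimate hX hS hmem hclosed (κ := k + 2) (κ₀ := k + 1)
      (by positivity) (by push_cast; linarith) (hcon _)
  have hk : ∀ k : ℕ, (0 : ℝ) < ((k : ℝ) + 1)⁻¹ := fun k => by positivity
  obtain ⟨⟨u, v⟩, -, θ, hθ, hlim⟩ :=
    ((isCompact_closedBall (0 : E) 1).prod (isCompact_closedBall (0 : F) 1)).tendsto_subseq
      (x := fun k : ℕ => (((k : ℝ) + 1)⁻¹ • (w k).fst, ((k : ℝ) + 1)⁻¹ • (w k).snd)) (fun k => by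
        constructor
        · rw [mem_closedBall_zero_iff, norm_smul, Real.norm_of_nonneg (hk k).le, hw1,
            inv_mul_cancel₀ (by positivity)]
        · rw [mem_closedBall_zero_iff, norm_smul, Real.norm_of_nonneg (hk k).le]
          exact mul_le_one₀ (inv_le_one_of_one_le₀ (by simp)) (norm_nonneg _) (hw2 k))
  have hlu : Tendsto (fun k => ((θ k : ℝ) + 1)⁻¹ • (w (θ k)).fst) atTop (𝓝 u) :=
    (continuous_fst.tendsto (u, v)).comp hlim
  have hlv : Tendsto (fun k => ((θ k : ℝ) + 1)⁻¹ • (w (θ k)).snd) atTop (𝓝 v) :=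
    (continuous_snd.tendsto (u, v)).comp hlim
  have hu : ‖u‖ = 1 := by
    refine tendsto_nhds_unique hlu.norm (tendsto_const_nhds.congr fun k => ?_)
    rw [norm_smul, Real.norm_of_nonneg (hk _).le, hw1, inv_mul_cancel₀ (by positivity)]
  have hv : v = 0 := by
    refine tendsto_nhds_unique hlv (squeeze_zero_norm (fun k => ?_)
      ((tendsto_one_div_add_atTop_nhds_zero_nat (𝕜 := ℝ)).comp hθ.tendsto_atTop))
    rw [norm_smul, Real.norm_of_nonneg (hk _).le, Function.comp_apply, one_div]
    exact mul_le_of_le_one_right (hk _).le (hw2 _)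
  have huT : u ∈ tangentVectors X x₀ := by
    rw [← hT]
    refine (Submodule.closed_of_finiteDimensional T).mem_of_tendsto hlu (.of_forall fun k => ?_)
    exact T.smul_mem _ (show (w (θ k)).fst ∈ (T : Set E) from hT ▸ hwT _)
  have huN : WithLp.toLp 2 (u, v) ∈
      limitingNormalCone (setGraph S) (WithLp.toLp 2 (x₀, y₀)) := by
    refine (isClosed_limitingNormalCone _ _).mem_of_tendsto
      (((WithLp.prod_continuous_toLp 2 E F).tendsto _).comp hlim) (.of_forall fun k => ?_)
    exact smul_mem_limitingNormalCone (hk (θ k)) (hwN (θ k))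
  have : u = 0 := hcrit _ huN huT hv
  simp [this] at hu

theorem graphicalModulus_eq_outerNorm {d : ℕ} {X : Set E} (hX : IsC1Submanifold d X)
    {S : E → Set F} (hS : ∀ x, x ∉ X → S x = ∅) {x₀ : E} {y₀ : F} (hmem : y₀ ∈ S x₀)
    (hclosed : LocallyClosedAt (setGraph S) (WithLp.toLp 2 (x₀, y₀))) :
    graphicalModulus S X x₀ y₀ = outerNorm (tangentialCoderivative S X x₀ y₀) := by
  apply le_antisymm
  · by_contra! hlt
    -- Two constants fit in the gap: `κ` is below the modulus, so not admissible, and `κ₀ < κ` still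
    -- exceeds the outer norm.
    obtain ⟨κ, h1, h2⟩ := ENNReal.lt_iff_exists_nnreal_btwn.1 hlt
    obtain ⟨κ₀, h3, h4⟩ := ENNReal.lt_iff_exists_nnreal_btwn.1 h1
    have hκ : ¬ AubinEstimate S X x₀ y₀ κ := fun h => h2.not_ge (iInf₂_le κ h)
    have h0 : 0 < κ₀ := by exact_mod_cast (zero_le).trans_lt h3
    obtain ⟨w, hw, hwT, hw1, hw2⟩ := exists_normal_of_not_aubinEstimate hX hS hmem hclosed
      (NNReal.coe_pos.2 h0) (by exact_mod_cast h4) hκ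
    have hz : w.fst ∈ tangentialCoderivative S X x₀ y₀ (-w.snd) :=
      ⟨fst_mem_limitingCoderivative hw, hwT⟩
    have hle : ‖w.fst‖ₑ ≤ outerNorm (tangentialCoderivative S X x₀ y₀) :=
      le_iSup₂_of_le (-w.snd) (by simpa using hw2)
        (le_iSup₂ (f := fun z (_ : z ∈ tangentialCoderivative S X x₀ y₀ (-w.snd)) => ‖z‖ₑ) _ hz)
    have he : ‖w.fst‖ₑ = κ₀ := by
      rw [enorm_eq_nnnorm]
      exact congrArg _ (NNReal.eq hw1)
    exact (he ▸ hle).not_gt h3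
  · refine le_iInf₂ fun κ hκ => iSup₂_le fun w hw => iSup₂_le fun z hz => ?_
    have h1 := norm_fst_le_of_aubinEstimate hX hS hmem hκ hz.1 hz.2
    change ‖z‖ ≤ κ * ‖-w‖ at h1
    rw [norm_neg] at h1
    have h2 : ‖z‖ ≤ κ :=
      h1.trans (mul_le_of_le_one_right κ.2 (mem_closedBall_zero_iff.1 hw))
    rw [enorm_eq_nnnorm]
    exact_mod_cast h2

end Criterion

/-- A set-valued map `𝒳 ⇉ ℝᵐ` is a set-valued map on `ℝⁿ` whose values off `𝒳` are empty. The
quotients are taken in `[0, ∞]`; under the hypothesis, `v = 0` forces `u = 0`, and `0 / 0 = 0`. -/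
theorem proposition3p3 (n m d : ℕ) (X : Set (EuclideanSpace ℝ (Fin n)))
    (hX : IsC1Submanifold d X)
    (S : EuclideanSpace ℝ (Fin n) → Set (EuclideanSpace ℝ (Fin m)))
    (hS : ∀ x, x ∉ X → S x = ∅)
    (xbar : EuclideanSpace ℝ (Fin n)) (ybar : EuclideanSpace ℝ (Fin m))
    (hmem : ybar ∈ S xbar)
    (hclosed : LocallyClosedAt (setGraph S) (WithLp.toLp 2 (xbar, ybar))) :
    (tangentialCoderivative S X xbar ybar 0 = {0} ↔
      limitingNormalCone (setGraph S) (WithLp.toLp 2 (xbar, ybar)) ∩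
        {w | w.fst ∈ tangentVectors X xbar ∧ w.snd = 0} = {0}) ∧
    (tangentialCoderivative S X xbar ybar 0 = {0} →
      HasAubinProperty S X xbar ybar ∧
      graphicalModulus S X xbar ybar = outerNorm (tangentialCoderivative S X xbar ybar) ∧
      outerNorm (tangentialCoderivative S X xbar ybar) =
        ⨆ w ∈ limitingNormalCone (setGraph S) (WithLp.toLp 2 (xbar, ybar)) ∩
          {w | w.fst ∈ tangentVectors X xbar}, ‖w.fst‖ₑ / ‖w.snd‖ₑ) := by
  have hx : xbar ∈ X := by
    by_contra hx
    simp [hS xbar hx] at hmem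
  have hH := tangentialCoderivative_zero_eq_iff (S := S) hx hmem
  refine ⟨hH.trans (limitingNormalCone_inter_eq_iff hx hmem).symm, fun h => ?_⟩
  rw [hH] at h
  exact ⟨⟨hx, hmem, hclosed, exists_aubinEstimate hX hS hmem hclosed h⟩,
    graphicalModulus_eq_outerNorm hX hS hmem hclosed,
    outerNorm_tangentialCoderivative_eq hX hx h⟩
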